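/- For a finite simple graph $G$ let $C(G)$ denote the number of cycles of $G$, where a cycle is a subgraph of $G$ (so the starting vertex and the direction of traversal are irrelevant). For an integer $m\ge 0$ let $C(m)$ be the maximum of $C(G)$ over all finite simple graphs $G$ with exactly $m$ edges (this maximum exists). Then for every integer $m\ge 0$, $$C(m) < 8.25\cdot\bigl(\sqrt[3]{3}\bigr)^{m}.$$ Consequently, for every integer $m>4056$, $$C(m) < 1.443^{m}.$$ -/

import Mathlib

/-- The set of cycles of a simple graph. A cycle is a subgraph (a set of vertices together with a
set of edges), so a closed walk and its rotations and reversal give the same cycle.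
`SimpleGraph.Walk.IsCycle` says that the walk is nontrivial, repeats no edge, and repeats no vertex
except that it ends where it starts; so the length is at least 3. -/
def cycleSet {V : Type*} (G : SimpleGraph V) : Set G.Subgraph :=
  {C | ∃ (v : V) (p : G.Walk v v), p.IsCycle ∧ p.toSubgraph = C}

/-- The number `C(G)` of cycles of `G` (used for finite graphs, where `cycleSet G` is finite). -/
noncomputable def numCycles {V : Type*} (G : SimpleGraph V) : ℕ :=
  (cycleSet G).ncard

/-- The set of values of `C(G)`, where `G` runs over all finite simple graphs with `m` edges. -/
def cycleCounts (m : ℕ) : Set ℕ :=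
  {c | ∃ (V : Type) (_ : Finite V) (G : SimpleGraph V), G.edgeSet.ncard = m ∧ numCycles G = c}

/-- `C(m)`, the maximum number of cycles in a finite simple graph with `m` edges. -/
noncomputable def maxCycles (m : ℕ) : ℕ :=
  sSup (cycleCounts m)

/-! Let `a` be the cube root of 3. A path from `s` to `t ≠ s` leaves `s` along one of its `d` edges
and never returns to `s`, so by induction there are at most `d * a ^ (m - d) ≤ a ^ m` such paths
(`ncard_setOf_isPath_le`); the base is forced by `d ≤ a ^ d`, which is sharp at `d = 3`. Cycles
through an edge `uv` correspond to paths from `v` to `u` in the graph without `uv`. Removing the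
edges one at a time therefore bounds the number of cycles by the geometric sum of `a ^ i` over `i <
m`, which is less than `a ^ m / (a - 1)`. Since `1 / (a - 1) < 2.5`, this is stronger than the bound
with 8.25. -/

/-- If `a` is the cube root of `3`, then `d ≤ a ^ d`, with equality for `d = 3`. -/
theorem natCast_le_pow_of_cube_eq_three {a : ℝ} (ha0 : 0 < a) (ha : a ^ 3 = 3) (d : ℕ) :
    (d : ℝ) ≤ a ^ d := by
  have key : d ^ 3 ≤ 3 ^ d := by
    rcases Nat.lt_or_ge d 3 with h | h
    · interval_cases d <;> norm_num
    · induction d, h using Nat.le_induction with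
      | base => norm_num
      | succ n hn ih =>
        rw [pow_succ 3 n]
        -- It suffices that `(n + 1) ^ 3 ≤ 3 * n ^ 3`, which holds for `n ≥ 3`.
        nlinarith [Nat.mul_le_mul hn hn, Nat.mul_le_mul (Nat.mul_le_mul hn hn) hn,
          Nat.mul_le_mul_right (n * n) hn, Nat.mul_le_mul_right n hn]
  refine le_of_pow_le_pow_left₀ (n := 3) (by norm_num) (by positivity) ?_
  rw [← pow_mul, mul_comm, pow_mul, ha]
  exact_mod_cast key

namespace SimpleGraph

variable {V : Type*}

/-- A path with distinct ends is a first edge followed by a path that avoids the first vertex. -/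
theorem Walk.IsPath.exists_cons_mapLe {G : SimpleGraph V} {s t : V} (hst : s ≠ t)
    {p : G.Walk s t} (hp : p.IsPath) :
    ∃ (w : V) (h : G.Adj s w) (q : (G.deleteIncidenceSet s).Walk w t),
      q.IsPath ∧ Walk.cons h (q.mapLe (G.deleteIncidenceSet_le s)) = p := by
  cases p with
  | nil => exact absurd rfl hst
  | @cons _ w _ h r =>
    rw [Walk.cons_isPath_iff] at hp
    have hr : ∀ e ∈ r.edges, e ∈ (G.deleteIncidenceSet s).edgeSet := by
      intro e he
      induction e with
      | _ x y =>
        refine deleteIncidenceSet_adj.2 ?_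
        refine ⟨r.adj_of_mem_edges he, ?_, ?_⟩
        · rintro rfl
          exact hp.2 (r.fst_mem_support_of_mem_edges he)
        · rintro rfl
          exact hp.2 (r.snd_mem_support_of_mem_edges he)
    refine ⟨w, h, r.transfer _ hr, hp.1.transfer hr, ?_⟩
    rw [Walk.mapLe, ← Walk.transfer_eq_map_ofLE _ (by simpa using r.edges_subset_edgeSet),
      Walk.transfer_transfer, Walk.transfer_self]

/-- A graph with `m` edges has at most `3 ^ (m / 3)` paths between two given vertices. -/
theorem ncard_setOf_isPath_le [Finite V] {a : ℝ} (ha0 : 0 < a) (ha : a ^ 3 = 3)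
    (G : SimpleGraph V) (s t : V) :
    {p : G.Walk s t | p.IsPath}.Finite ∧
      ({p : G.Walk s t | p.IsPath}.ncard : ℝ) ≤ a ^ G.edgeSet.ncard := by
  classical
  have := Fintype.ofFinite V
  have ha1 : 1 ≤ a := by
    by_contra! h
    have := pow_lt_one₀ ha0.le h (n := 3) (by norm_num)
    linarith
  induction hm : G.edgeSet.ncard using Nat.strong_induction_on generalizing G s with
  | _ m ih =>
    by_cases hst : s = t
    · subst hst
      have : {p : G.Walk s s | p.IsPath} = {Walk.nil} := by
        ext p
        simp
      rw [this]
      simpa using one_le_pow₀ ha1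
    · set H := G.deleteIncidenceSet s with hH
      have hcard : H.edgeSet.ncard = m - G.degree s := by
        have := card_edgeFinset_deleteIncidenceSet G s
        rw [← hm, ← coe_edgeFinset G, ← coe_edgeFinset H, Set.ncard_coe_finset,
          Set.ncard_coe_finset]
        convert this
      have hdeg : G.degree s ≤ m := by
        rw [← hm, ← coe_edgeFinset G, Set.ncard_coe_finset]
        exact G.degree_le_card_edgeFinset s
      -- `Option` makes `f` total in `w`; the value `none` is never used, since the union below runs
      -- over neighbours of `s` only.
      let f (w : V) (q : H.Walk w t) : Option (G.Walk s t) :=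
        if h : G.Adj s w then some (Walk.cons h (q.mapLe (G.deleteIncidenceSet_le s))) else none
      have hsub : some '' {p : G.Walk s t | p.IsPath} ⊆
          ⋃ w ∈ G.neighborFinset s, f w '' {q : H.Walk w t | q.IsPath} := by
        rintro _ ⟨p, hp, rfl⟩
        obtain ⟨w, h, q, hq, rfl⟩ := Walk.IsPath.exists_cons_mapLe hst hp
        simp only [Set.mem_iUnion, mem_neighborFinset]
        exact ⟨w, h, q, hq, by simp [f, h]⟩
      have hpos : ∀ w ∈ G.neighborFinset s, 0 < G.degree s := fun w hw =>
        Finset.card_pos.2 ⟨w, hw⟩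
      -- Finiteness is carried through the induction because `ncard` is 0 on infinite sets. The edge
      -- count drops strictly because a neighbour `w` exists.
      have ih' : ∀ w ∈ G.neighborFinset s, {q : H.Walk w t | q.IsPath}.Finite ∧
          ({q : H.Walk w t | q.IsPath}.ncard : ℝ) ≤ a ^ (m - G.degree s) := fun w hw =>
        ih (m - G.degree s) (by have := hpos w hw; omega) H w hcard
      have hfin : (⋃ w ∈ G.neighborFinset s, f w '' {q : H.Walk w t | q.IsPath}).Finite :=
        (G.neighborFinset s).finite_toSet.biUnion fun w hw => (ih' w hw).1.image _
      refine ⟨(hfin.subset hsub).of_finite_image (Option.some_injective _).injOn, ?_⟩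
      have hle : {p : G.Walk s t | p.IsPath}.ncard ≤
          ∑ w ∈ G.neighborFinset s, {q : H.Walk w t | q.IsPath}.ncard := by
        rw [← Set.ncard_image_of_injective _ (Option.some_injective _)]
        refine (Set.ncard_le_ncard hsub hfin).trans
          ((Finset.set_ncard_biUnion_le _ _).trans (Finset.sum_le_sum fun w hw => ?_))
        exact Set.ncard_image_le (ih' w hw).1
      calc ({p : G.Walk s t | p.IsPath}.ncard : ℝ)
          ≤ ∑ w ∈ G.neighborFinset s, ({q : H.Walk w t | q.IsPath}.ncard : ℝ) := by
            exact_mod_cast hle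
        _ ≤ ∑ w ∈ G.neighborFinset s, a ^ (m - G.degree s) :=
            Finset.sum_le_sum fun w hw => (ih' w hw).2
        _ = G.degree s * a ^ (m - G.degree s) := by simp
        _ ≤ a ^ G.degree s * a ^ (m - G.degree s) := by
            gcongr
            exact natCast_le_pow_of_cube_eq_three ha0 ha _
        _ = a ^ m := by rw [← pow_add]; congr 1; omega

/-- A cycle traversing the dart `(u, v)` can be rotated so as to start with this dart. -/
theorem Walk.IsCycle.exists_cons_of_mem_darts {G : SimpleGraph V} {w : V} {c : G.Walk w w}
    (hc : c.IsCycle) {d : G.Dart} (hd : d ∈ c.darts) :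
    ∃ q : G.Walk d.snd d.fst, (Walk.cons d.adj q).IsCycle ∧
      (Walk.cons d.adj q).toSubgraph = c.toSubgraph := by
  have split : ∀ {x y : V} (p : G.Walk x y), d ∈ p.darts →
      ∃ (q : G.Walk x d.fst) (r : G.Walk d.snd y), p = q.append (Walk.cons d.adj r) := by
    intro x y p
    induction p with
    | nil => simp
    | cons h p ih =>
      intro hp
      rw [Walk.darts_cons, List.mem_cons] at hp
      rcases hp with rfl | hp
      · exact ⟨Walk.nil, p, rfl⟩
      · obtain ⟨q, r, rfl⟩ := ih hp
        exact ⟨Walk.cons h q, r, rfl⟩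
  obtain ⟨q, r, rfl⟩ := split c hd
  refine ⟨r.append q, ?_, ?_⟩
  -- Rotation only permutes the edge list and the tail of the support, so both stay free of
  -- duplicates.
  · rw [Walk.isCycle_def, Walk.isTrail_def] at hc ⊢
    obtain ⟨h1, -, h3⟩ := hc
    refine ⟨?_, by simp, ?_⟩
    · refine (List.Perm.nodup_iff ?_).1 h1
      rw [← Walk.cons_append, Walk.edges_append, Walk.edges_append]
      exact List.perm_append_comm
    · refine (List.Perm.nodup_iff ?_).1 h3
      rw [← Walk.cons_append, Walk.tail_support_append, Walk.tail_support_append]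
      exact List.perm_append_comm
  · rw [← Walk.cons_append, Walk.toSubgraph_append, Walk.toSubgraph_append, sup_comm]

/-- A cycle through the edge `uv` consists of this edge and a path of `G - uv`. -/
theorem exists_isPath_of_mem_cycleSet {G : SimpleGraph V} {u v : V} (huv : G.Adj u v)
    {C : G.Subgraph} (hC : C ∈ cycleSet G) (he : s(u, v) ∈ C.edgeSet) :
    ∃ q : (G.deleteEdges {s(u, v)}).Walk v u, q.IsPath ∧
      (Walk.cons huv (q.mapLe (G.deleteEdges_le {s(u, v)}))).toSubgraph = C := by
  obtain ⟨w, c, hc, rfl⟩ := hC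
  rw [Walk.mem_edges_toSubgraph] at he
  obtain ⟨d, hd, hde⟩ := List.mem_map.1 he
  obtain ⟨q, hq, hqc⟩ : ∃ q : G.Walk v u, (Walk.cons huv q).IsCycle ∧
      (Walk.cons huv q).toSubgraph = c.toSubgraph := by
    obtain ⟨⟨x, y⟩, hxy⟩ := d
    rcases Sym2.eq_iff.1 hde with ⟨rfl, rfl⟩ | ⟨rfl, rfl⟩
    · exact hc.exists_cons_of_mem_darts hd
    -- The cycle traverses the edge from `v` to `u`, so its reverse is rotated instead.
    · have hd' : (⟨(x, y), hxy⟩ : G.Dart).symm ∈ c.reverse.darts := by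
        rw [Walk.mem_darts_reverse, Dart.symm_symm]
        exact hd
      obtain ⟨q, h1, h2⟩ := hc.reverse.exists_cons_of_mem_darts hd'
      exact ⟨q, h1, h2.trans c.toSubgraph_reverse⟩
  rw [Walk.cons_isCycle_iff] at hq
  have hr : ∀ e ∈ q.edges, e ∈ (G.deleteEdges {s(u, v)}).edgeSet := by
    intro e he
    rw [edgeSet_deleteEdges]
    refine ⟨q.edges_subset_edgeSet he, ?_⟩
    rintro rfl
    exact hq.2 he
  refine ⟨q.transfer _ hr, hq.1.transfer hr, ?_⟩
  rw [Walk.mapLe, ← Walk.transfer_eq_map_ofLE _ (by simpa using q.edges_subset_edgeSet),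
    Walk.transfer_transfer, Walk.transfer_self, hqc]

/-- The cycles of `G` that avoid an edge are the cycles of the graph without this edge. -/
theorem exists_mem_cycleSet_deleteEdges {G : SimpleGraph V} {e : Sym2 V}
    {C : G.Subgraph} (hC : C ∈ cycleSet G) (he : e ∉ C.edgeSet) :
    ∃ D ∈ cycleSet (G.deleteEdges {e}), D.map (Hom.ofLE (G.deleteEdges_le {e})) = C := by
  obtain ⟨w, c, hc, rfl⟩ := hC
  rw [Walk.mem_edges_toSubgraph] at he
  have hr : ∀ f ∈ c.edges, f ∈ (G.deleteEdges {e}).edgeSet := by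
    intro f hf
    rw [edgeSet_deleteEdges]
    refine ⟨c.edges_subset_edgeSet hf, ?_⟩
    rintro rfl
    exact he hf
  refine ⟨_, ⟨w, c.transfer _ hr, hc.transfer hr, rfl⟩, ?_⟩
  rw [← Walk.toSubgraph_map,
    ← Walk.transfer_eq_map_ofLE _ (by simpa using c.edges_subset_edgeSet),
    Walk.transfer_transfer, Walk.transfer_self]

/-- The number of cycles grows by at most the number of paths between its ends when an edge is
added. -/
theorem numCycles_le_add [Finite V] {a : ℝ} (ha0 : 0 < a) (ha : a ^ 3 = 3)
    (G : SimpleGraph V) {u v : V} (huv : G.Adj u v) :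
    (numCycles G : ℝ) ≤ a ^ (G.deleteEdges {s(u, v)}).edgeSet.ncard +
      numCycles (G.deleteEdges {s(u, v)}) := by
  obtain ⟨hfin, hle⟩ := ncard_setOf_isPath_le ha0 ha (G.deleteEdges {s(u, v)}) v u
  have hsub : cycleSet G ⊆
      (fun q : (G.deleteEdges {s(u, v)}).Walk v u =>
        (Walk.cons huv (q.mapLe (G.deleteEdges_le {s(u, v)}))).toSubgraph) '' {q | q.IsPath} ∪
      (fun D => D.map (Hom.ofLE (G.deleteEdges_le {s(u, v)}))) ''
        cycleSet (G.deleteEdges {s(u, v)}) := by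
    intro C hC
    by_cases he : s(u, v) ∈ C.edgeSet
    · exact Or.inl (exists_isPath_of_mem_cycleSet huv hC he)
    · exact Or.inr (exists_mem_cycleSet_deleteEdges hC he)
  have h : numCycles G ≤ {q : (G.deleteEdges {s(u, v)}).Walk v u | q.IsPath}.ncard +
      numCycles (G.deleteEdges {s(u, v)}) :=
    (Set.ncard_le_ncard hsub (Set.toFinite _)).trans <| (Set.ncard_union_le _ _).trans <|
      add_le_add (Set.ncard_image_le hfin) (Set.ncard_image_le (Set.toFinite _))
  calc (numCycles G : ℝ) ≤ {q : (G.deleteEdges {s(u, v)}).Walk v u | q.IsPath}.ncard +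
      numCycles (G.deleteEdges {s(u, v)}) := by exact_mod_cast h
    _ ≤ _ := by gcongr

/-- A graph with `m` edges has at most `∑ i < m, 3 ^ (i / 3)` cycles. -/
theorem numCycles_le_sum [Finite V] {a : ℝ} (ha0 : 0 < a) (ha : a ^ 3 = 3) (m : ℕ)
    (G : SimpleGraph V) (hm : G.edgeSet.ncard = m) :
    (numCycles G : ℝ) ≤ ∑ i ∈ Finset.range m, a ^ i := by
  induction m generalizing G with
  | zero =>
    have : cycleSet G = ∅ := by
      rw [Set.eq_empty_iff_forall_notMem]
      rintro _ ⟨w, c, hc, rfl⟩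
      rw [Set.ncard_eq_zero] at hm
      cases c with
      | nil => exact hc.ne_nil rfl
      | cons h p => exact Set.notMem_empty _ (hm ▸ G.mem_edgeSet.2 h)
    simp [numCycles, this]
  | succ m ih =>
    obtain ⟨e, he⟩ := Set.nonempty_of_ncard_ne_zero (hm.trans_ne m.succ_ne_zero)
    induction e with
    | _ u v =>
      have hm' : (G.deleteEdges {s(u, v)}).edgeSet.ncard = m := by
        rw [edgeSet_deleteEdges, Set.ncard_sdiff_singleton_of_mem he, hm, Nat.add_sub_cancel]
      have h := numCycles_le_add ha0 ha G he
      rw [hm'] at h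
      rw [Finset.sum_range_succ]
      linarith [ih _ hm']

end SimpleGraph

/-- For every `m` there is a finite graph with `m` edges. -/
theorem cycleCounts_nonempty (m : ℕ) : (cycleCounts m).Nonempty := by
  obtain ⟨s, hs, hcard⟩ : ∃ s ⊆ (⊤ : SimpleGraph (Fin (m + 2))).edgeFinset, s.card = m := by
    refine Finset.exists_subset_card_eq ?_
    rw [SimpleGraph.card_edgeFinset_top_eq_card_choose_two, Fintype.card_fin,
      Nat.choose_succ_succ, Nat.choose_one_right]
    omega
  refine ⟨_, Fin (m + 2), inferInstance, SimpleGraph.fromEdgeSet (s : Set (Sym2 _)), ?_, rfl⟩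
  rw [SimpleGraph.edgeSet_fromEdgeSet, sdiff_eq_left.2, Set.ncard_coe_finset, hcard]
  rw [Set.disjoint_left]
  intro e he hdiag
  have := hs he
  rw [SimpleGraph.mem_edgeFinset] at this
  exact SimpleGraph.not_isDiag_of_mem_edgeSet _ this hdiag

theorem corollary4 (m : ℕ) :
    IsGreatest (cycleCounts m) (maxCycles m) ∧
    (maxCycles m : ℝ) < 8.25 * (3 : ℝ) ^ ((m : ℝ) / 3) ∧
    (4056 < m → (maxCycles m : ℝ) < (1.443 : ℝ) ^ m) := by
  set a : ℝ := (3 : ℝ) ^ ((1 : ℝ) / 3) with ha_def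
  have ha0 : 0 < a := by positivity
  have ha : a ^ 3 = 3 := by
    rw [ha_def, ← Real.rpow_natCast, ← Real.rpow_mul (by norm_num)]
    norm_num
  have hapow : (3 : ℝ) ^ ((m : ℝ) / 3) = a ^ m := by
    rw [ha_def, ← Real.rpow_natCast, ← Real.rpow_mul (by norm_num)]
    congr 1
    ring
  have ha1 : 1.44 < a := lt_of_pow_lt_pow_left₀ 3 ha0.le (by rw [ha]; norm_num)
  -- From `a > 1.44`, `1 / (a - 1) < 1 / 0.44 < 2.5`.
  have hsum : ∑ i ∈ Finset.range m, a ^ i < 2.5 * a ^ m := by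
    have h := geom_sum_mul a m
    have hpos : 0 ≤ ∑ i ∈ Finset.range m, a ^ i := Finset.sum_nonneg fun i _ => by positivity
    have hm0 : 0 < a ^ m := by positivity
    nlinarith
  have hbound : ∀ c ∈ cycleCounts m, (c : ℝ) < 2.5 * a ^ m := by
    rintro _ ⟨V, _, G, hG, rfl⟩
    exact (G.numCycles_le_sum ha0 ha m hG).trans_lt hsum
  have hbdd : BddAbove (cycleCounts m) := by
    refine ⟨⌈2.5 * a ^ m⌉₊, fun c hc => ?_⟩
    exact_mod_cast (hbound c hc).le.trans (Nat.le_ceil _)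
  -- `sSup` on `ℕ` defaults to 0 for empty or unbounded sets, so both properties are needed for the
  -- maximum to be attained.
  have hmem : maxCycles m ∈ cycleCounts m := Nat.sSup_mem (cycleCounts_nonempty m) hbdd
  refine ⟨⟨hmem, fun c hc => le_csSup hbdd hc⟩, ?_, fun hm => ?_⟩
  · rw [hapow]
    have hm0 : 0 < a ^ m := by positivity
    linarith [hbound _ hmem]
  -- The ratio `1.443 / a` exceeds 1.0005, and by Bernoulli `1.0005 ^ m ≥ 1 + 0.0005 * 4056 > 2.5`,
  -- which absorbs the constant factor.
  · have ha2 : a * (1 + 0.0005) ≤ 1.443 := by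
      have : a ≤ 1.44225 :=
        le_of_pow_le_pow_left₀ (n := 3) (by norm_num) (by norm_num) (by rw [ha]; norm_num)
      linarith
    have hbern := one_add_mul_le_pow (a := (0.0005 : ℝ)) (by norm_num) m
    have hm' : (4056 : ℝ) ≤ m := by exact_mod_cast hm.le
    calc (maxCycles m : ℝ) < 2.5 * a ^ m := hbound _ hmem
      _ ≤ (1 + 0.0005) ^ m * a ^ m := by
        gcongr
        linarith
      _ = (a * (1 + 0.0005)) ^ m := by rw [mul_pow, mul_comm]
      _ ≤ 1.443 ^ m := by gcongr
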